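/- Let $T,\rho,r,p>0$, $\eta,\xi\ge 0$, $\theta\in(0,1)$, $C\ge 0$, $Z\ge 0$, $a_0\ge 0$ and $x_0\in[0,1]$. Let $w\in C^2(\mathbb{R})$ be bounded, with $w>0$ on $(0,1)$, $w<0$ outside $[0,1]$, $w'>0$ on $(-\infty,0]$ and $w'<0$ on $[1,\infty)$. For functions $c,z$ on $[0,T]$, the corresponding states $a,x$ are the absolutely continuous functions on $[0,T]$ with $a(0)=a_0$, $x(0)=x_0$ and, for almost every $t\in[0,T]$, $$\dot a(t)=r\,a(t)+w(x(t))-p\,c(t)-\xi z(t)^2,\qquad \dot x(t)=z(t).$$ Let $\Delta$ be the set of pairs $(c,z)$ of Lebesgue measurable functions on $[0,T]$ such that $0\le c(t)\le C$ and $|z(t)|\le Z$ for all $t\in[0,T]$, and whose corresponding states satisfy $a(T)\ge 0$. For $(c,z)\in\Delta$ put $$J(c,z)=\int_0^T e^{-\rho t}\left(\frac{c(t)^{1-\theta}}{1-\theta}-\eta z(t)^2\right)dt+e^{-\rho T}\,\frac{a(T)^{1-\theta}}{1-\theta}.$$ **Theorem.** The optimal control problem of maximizing $J$ over $\Delta$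 has a solution: there is $(\bar c,\bar z)\in\Delta$ such that $J(c,z)\le J(\bar c,\bar z)$ for all $(c,z)\in\Delta$. -/

import Mathlib

open MeasureTheory Set

/-- The data of the consumption/relocation problem: horizon `T`, discount rate `ρ`, interest rate
`r`, relocation costs `η` (in utility) and `ξ` (in money), price `p`, utility exponent `θ`, bounds
`C` and `Z` on the controls, initial assets `a₀`, initial location `x₀`, wage distribution `w`. -/
structure RelocationModel where
  T : ℝ
  ρ : ℝ
  r : ℝ
  η : ℝ
  ξ : ℝ
  p : ℝ
  θ : ℝ
  C : ℝ
  Z : ℝ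
  a₀ : ℝ
  x₀ : ℝ
  w : ℝ → ℝ

namespace RelocationModel

/-- The standing assumptions on the data. No lower bounds on `C` and `Z` other than
nonnegativity are imposed. -/
structure StandingAssumptions (M : RelocationModel) : Prop where
  T_pos : 0 < M.T
  ρ_pos : 0 < M.ρ
  r_pos : 0 < M.r
  η_nonneg : 0 ≤ M.η
  ξ_nonneg : 0 ≤ M.ξ
  p_pos : 0 < M.p
  θ_mem : M.θ ∈ Ioo (0 : ℝ) 1
  C_nonneg : 0 ≤ M.C
  Z_nonneg : 0 ≤ M.Z
  a₀_nonneg : 0 ≤ M.a₀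
  x₀_mem : M.x₀ ∈ Icc (0 : ℝ) 1
  w_contDiff : ContDiff ℝ 2 M.w
  w_bounded : ∃ B : ℝ, ∀ x, |M.w x| ≤ B
  w_pos : ∀ x ∈ Ioo (0 : ℝ) 1, 0 < M.w x
  w_neg : ∀ x, x ∉ Icc (0 : ℝ) 1 → M.w x < 0
  deriv_w_pos : ∀ x ∈ Iic (0 : ℝ), 0 < deriv M.w x
  deriv_w_neg : ∀ x ∈ Ici (1 : ℝ), deriv M.w x < 0

/-- `a` and `x` are the states corresponding to the controls `c` and `z`: they are absolutely
continuous on `[0, T]`, have the prescribed initial values, and solve the state equations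
`a' = r a + w(x) - p c - ξ z²` and `x' = z` almost everywhere on `[0, T]`. -/
structure IsTrajectory (M : RelocationModel) (c z a x : ℝ → ℝ) : Prop where
  absCont_assets : AbsolutelyContinuousOnInterval a 0 M.T
  absCont_location : AbsolutelyContinuousOnInterval x 0 M.T
  assets_init : a 0 = M.a₀
  location_init : x 0 = M.x₀
  assets_eq : ∀ᵐ t ∂(volume.restrict (Icc 0 M.T)),
    HasDerivAt a (M.r * a t + M.w (x t) - M.p * c t - M.ξ * z t ^ 2) t
  location_eq : ∀ᵐ t ∂(volume.restrict (Icc 0 M.T)), HasDerivAt x (z t) t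

/-- The set `Δ` of admissible controls `(c, z)`: Lebesgue measurable on `[0, T]`, within the
bounds `0 ≤ c ≤ C` and `|z| ≤ Z` there, and with nonnegative terminal assets. -/
def admissible (M : RelocationModel) : Set ((ℝ → ℝ) × (ℝ → ℝ)) :=
  {u | AEMeasurable u.1 (volume.restrict (Icc 0 M.T)) ∧
    AEMeasurable u.2 (volume.restrict (Icc 0 M.T)) ∧
    (∀ t ∈ Icc 0 M.T, 0 ≤ u.1 t ∧ u.1 t ≤ M.C) ∧
    (∀ t ∈ Icc 0 M.T, |u.2 t| ≤ M.Z) ∧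
    ∃ a x : ℝ → ℝ, M.IsTrajectory u.1 u.2 a x ∧ 0 ≤ a M.T}

/-- The objective functional, for controls `c`, `z` and the corresponding asset path `a`. -/
noncomputable def objective (M : RelocationModel) (c z a : ℝ → ℝ) : ℝ :=
  (∫ t in (0 : ℝ)..M.T,
      Real.exp (-M.ρ * t) * (c t ^ (1 - M.θ) / (1 - M.θ) - M.η * z t ^ 2)) +
    Real.exp (-M.ρ * M.T) * (a M.T ^ (1 - M.θ) / (1 - M.θ))

/-- `(c, z)` solves the optimal control problem: it is admissible, and the value of the objective
at `(c, z)` is at least its value at any admissible pair `(c', z')`. (The states corresponding to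
given controls are unique on `[0, T]`, and those of an admissible pair exist by definition.) -/
def IsOptimal (M : RelocationModel) (c z : ℝ → ℝ) : Prop :=
  (c, z) ∈ M.admissible ∧
    ∀ a x : ℝ → ℝ, M.IsTrajectory c z a x →
      ∀ c' z' : ℝ → ℝ, (c', z') ∈ M.admissible →
        ∀ a' x' : ℝ → ℝ, M.IsTrajectory c' z' a' x' →
          M.objective c' z' a' ≤ M.objective c z a

end RelocationModel

/-! The proof is the direct method. The payoff depends on the controls through two numbers only: the
running utility, a concave integral functional of `(c, z)`, and the terminal assets, in which it is
monotone on the nonnegative axis. By variation of constants, the terminal assets are a positive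
multiple of a constant plus a concave integral functional of `(c, z)` plus the discounted total
wage. The wage `w` need not be concave, but it sees the controls only through the location path, and
location paths converge pointwise along a subsequence.

Weak compactness takes an elementary form: the closed convex hulls in L² of the tails of a sequence
have a common point (`nonempty_iInter_of_antitone_closed_convex`). Superlevel sets of concave
integral functionals are closed and convex, so such a point does at least as well as the limit for
every one of them (`IsConcaveIntegrand.exists_upper_limit`). For linear functionals both signs
apply, which identifies the limit location path. Hence `exists_isControl_ge_limit`: neither running
utility nor terminal assets drop in the limit of a maximizing sequence. -/

/-! ### Nested closed convex sets in a Hilbert space. -/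

open Filter Topology in
/-- A decreasing sequence of nonempty closed convex sets in a Hilbert space, the first of which is
bounded, has a common point. -/
theorem nonempty_iInter_of_antitone_closed_convex {F : Type*} [NormedAddCommGroup F]
    [InnerProductSpace ℝ F] [CompleteSpace F] {K : ℕ → Set F} (hanti : Antitone K)
    (hne : ∀ n, (K n).Nonempty) (hcl : ∀ n, IsClosed (K n)) (hconv : ∀ n, Convex ℝ (K n))
    (hbdd : Bornology.IsBounded (K 0)) : (⋂ n, K n).Nonempty := by
  -- Take the points of least norm. Their norms increase and stay bounded, and the variational
  -- inequality bounds squared distances by differences of squared norms, so they form a Cauchy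
  -- sequence.
  have hmin : ∀ n, ∃ v ∈ K n, ∀ w ∈ K n, ‖v‖ ^ 2 ≤ inner ℝ v w := by
    intro n
    obtain ⟨v, hv, h⟩ :=
      exists_norm_eq_iInf_of_complete_convex (hne n) (hcl n).isComplete (hconv n) 0
    refine ⟨v, hv, fun w hw => ?_⟩
    have := (norm_eq_iInf_iff_real_inner_le_zero (hconv n) hv).1 h w hw
    simp only [zero_sub, inner_neg_left, inner_sub_right, real_inner_self_eq_norm_sq] at this
    linarith
  choose v hv hvw using hmin
  have hdist : ∀ n m, n ≤ m → ‖v n - v m‖ ^ 2 ≤ ‖v m‖ ^ 2 - ‖v n‖ ^ 2 := by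
    intro n m hnm
    have := hvw n (v m) (hanti hnm (hv m))
    rw [norm_sub_sq_real]
    linarith
  have hmono : Monotone fun n => ‖v n‖ ^ 2 := fun n m hnm => by
    have := hdist n m hnm
    have := sq_nonneg ‖v n - v m‖
    simp only
    linarith
  obtain ⟨B, hB⟩ := hbdd.exists_norm_le
  have hbd : BddAbove (range fun n => ‖v n‖ ^ 2) := by
    refine ⟨B ^ 2, ?_⟩
    rintro _ ⟨n, rfl⟩
    exact pow_le_pow_left₀ (norm_nonneg _) (hB _ (hanti (Nat.zero_le n) (hv n))) 2
  have hlim := tendsto_atTop_ciSup hmono hbd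
  set L := ⨆ n, ‖v n‖ ^ 2
  have hL : ∀ n, ‖v n‖ ^ 2 ≤ L := fun n => le_ciSup hbd n
  have hcauchy : CauchySeq v := by
    refine cauchySeq_of_le_tendsto_0' (fun n => √(L - ‖v n‖ ^ 2)) (fun n m hnm => ?_) ?_
    · rw [dist_eq_norm]
      exact Real.le_sqrt_of_sq_le ((hdist n m hnm).trans (sub_le_sub_right (hL m) _))
    · have := (tendsto_const_nhds (x := L)).sub hlim
      rw [sub_self] at this
      simpa using this.sqrt
  obtain ⟨x, hx⟩ := cauchySeq_tendsto_of_complete hcauchy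
  refine ⟨x, mem_iInter.2 fun n => ?_⟩
  exact (hcl n).mem_of_tendsto hx
    (eventually_atTop.2 ⟨n, fun m hm => hanti hm (hv m)⟩)

/-! ### Concave integral functionals and generalized limits. -/

section ConcaveIntegrand

variable {α E : Type*} [MeasurableSpace α] [NormedAddCommGroup E] [InnerProductSpace ℝ E]
  [MeasurableSpace E]

/-- `φ` is a bounded measurable integrand that is concave and continuous on `R` in its second
variable. -/
structure IsConcaveIntegrand (μ : Measure α) (R : Set E) (φ : α → E → ℝ) : Prop where
  concaveOn : ∀ t, ConcaveOn ℝ R (φ t)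
  continuousOn : ∀ t, ContinuousOn (φ t) R
  measurable : Measurable (Function.uncurry φ)
  bounded : ∃ B : ℝ, ∀ᵐ t ∂μ, ∀ v ∈ R, |φ t v| ≤ B

variable {μ : Measure α} {R : Set E} {φ : α → E → ℝ}

namespace IsConcaveIntegrand

/-- At level `0` its superlevel set is just the constraint of taking values in `R` almost
everywhere. -/
theorem zero (hR : Convex ℝ R) : IsConcaveIntegrand μ R fun _ _ => 0 where
  concaveOn _ := concaveOn_const 0 hR
  continuousOn _ := continuousOn_const
  measurable := measurable_const
  bounded := ⟨0, by simp⟩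

variable [BorelSpace E]

theorem aestronglyMeasurable (hφ : IsConcaveIntegrand μ R φ) {f : α → E}
    (hf : AEStronglyMeasurable f μ) : AEStronglyMeasurable (fun t => φ t (f t)) μ :=
  (hφ.measurable.comp_aemeasurable (aemeasurable_id.prodMk hf.aemeasurable)).aestronglyMeasurable

theorem integrable [IsFiniteMeasure μ] (hφ : IsConcaveIntegrand μ R φ) {f : α → E}
    (hf : AEStronglyMeasurable f μ) (hfR : ∀ᵐ t ∂μ, f t ∈ R) :
    Integrable (fun t => φ t (f t)) μ := by
  obtain ⟨B, hB⟩ := hφ.bounded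
  refine Integrable.of_bound (hφ.aestronglyMeasurable hf) B ?_
  filter_upwards [hB, hfR] with t h1 h2 using h1 _ h2

theorem convex_superlevel [IsFiniteMeasure μ] (hφ : IsConcaveIntegrand μ R φ) (hR : Convex ℝ R)
    (m : ℝ) : Convex ℝ {f : Lp E 2 μ | (∀ᵐ t ∂μ, f t ∈ R) ∧ m ≤ ∫ t, φ t (f t) ∂μ} := by
  rintro f ⟨hf, hfm⟩ g ⟨hg, hgm⟩ a b ha hb hab
  have hcoe : ∀ᵐ t ∂μ, (a • f + b • g : Lp E 2 μ) t = a • f t + b • g t := by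
    filter_upwards [Lp.coeFn_add (a • f) (b • g), Lp.coeFn_smul a f, Lp.coeFn_smul b g]
      with t h1 h2 h3
    rw [h1, Pi.add_apply, h2, h3]
    rfl
  have hmem : ∀ᵐ t ∂μ, (a • f + b • g : Lp E 2 μ) t ∈ R := by
    filter_upwards [hcoe, hf, hg] with t h h1 h2
    rw [h]
    exact hR h1 h2 ha hb hab
  refine ⟨hmem, ?_⟩
  have hif := hφ.integrable (Lp.aestronglyMeasurable f) hf
  have hig := hφ.integrable (Lp.aestronglyMeasurable g) hg
  calc m = a * m + b * m := by rw [← add_mul, hab, one_mul]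
    _ ≤ a * ∫ t, φ t (f t) ∂μ + b * ∫ t, φ t (g t) ∂μ := by gcongr
    _ = ∫ t, (a * φ t (f t) + b * φ t (g t)) ∂μ := by
      rw [integral_add (hif.const_mul a) (hig.const_mul b), integral_const_mul, integral_const_mul]
    _ ≤ ∫ t, φ t ((a • f + b • g : Lp E 2 μ) t) ∂μ := by
      refine integral_mono_ae ((hif.const_mul a).add (hig.const_mul b))
        (hφ.integrable (Lp.aestronglyMeasurable _) hmem) ?_
      filter_upwards [hcoe, hf, hg] with t h h1 h2
      rw [h]
      exact (hφ.concaveOn t).2 h1 h2 ha hb hab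

-- L² convergence yields an almost everywhere convergent subsequence, and the uniform bound on the
-- integrand permits dominated convergence.
open Filter Topology in
theorem isClosed_superlevel [IsFiniteMeasure μ] (hφ : IsConcaveIntegrand μ R φ) (hR : IsClosed R)
    (m : ℝ) : IsClosed {f : Lp E 2 μ | (∀ᵐ t ∂μ, f t ∈ R) ∧ m ≤ ∫ t, φ t (f t) ∂μ} := by
  refine IsSeqClosed.isClosed fun u f hu huf => ?_
  obtain ⟨ns, -, hns⟩ := (tendstoInMeasure_of_tendsto_Lp huf).exists_seq_tendsto_ae
  have huR : ∀ᵐ t ∂μ, ∀ n, u n t ∈ R := ae_all_iff.2 fun n => (hu n).1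
  have hfR : ∀ᵐ t ∂μ, f t ∈ R := by
    filter_upwards [hns, huR] with t h1 h2
    exact hR.mem_of_tendsto h1 (Eventually.of_forall fun n => h2 _)
  refine ⟨hfR, ?_⟩
  obtain ⟨B, hB⟩ := hφ.bounded
  have hlim : Tendsto (fun n => ∫ t, φ t (u (ns n) t) ∂μ) atTop (𝓝 (∫ t, φ t (f t) ∂μ)) := by
    refine tendsto_integral_of_dominated_convergence (fun _ => B)
      (fun n => hφ.aestronglyMeasurable (Lp.aestronglyMeasurable _)) (integrable_const B) ?_ ?_
    · intro n
      filter_upwards [hB, huR] with t h1 h2 using h1 _ (h2 _)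
    · filter_upwards [hns, huR, hfR] with t h1 h2 h3
      exact (hφ.continuousOn t _ h3).tendsto.comp
        (tendsto_nhdsWithin_iff.2 ⟨h1, Eventually.of_forall fun n => h2 _⟩)
  exact ge_of_tendsto' hlim fun n => (hu _).2

open Filter Topology in
/-- A sequence of functions with values in a bounded closed convex set has a generalized limit
at which every concave integral functional is at least the limit of its values along
the sequence. -/
theorem exists_upper_limit [IsFiniteMeasure μ] [CompleteSpace E] (hRcl : IsClosed R)
    (hRconv : Convex ℝ R) (hRbdd : Bornology.IsBounded R) {u : ℕ → α → E}
    (hu : ∀ n, AEStronglyMeasurable (u n) μ) (huR : ∀ n, ∀ᵐ t ∂μ, u n t ∈ R) :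
    ∃ v : α → E, AEStronglyMeasurable v μ ∧ (∀ᵐ t ∂μ, v t ∈ R) ∧
      ∀ (φ : α → E → ℝ) (m : ℝ), IsConcaveIntegrand μ R φ →
        Tendsto (fun n => ∫ t, φ t (u n t) ∂μ) atTop (𝓝 m) → m ≤ ∫ t, φ t (v t) ∂μ := by
  obtain ⟨B, hB⟩ := hRbdd.exists_norm_le
  have hB' : ∀ v ∈ R, ‖v‖ ≤ |B| := fun v hv => (hB v hv).trans (le_abs_self B)
  have hLp : ∀ n, MemLp (u n) 2 μ := fun n =>
    MemLp.of_bound (hu n) |B| ((huR n).mono fun t ht => hB' _ ht)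
  set U : ℕ → Lp E 2 μ := fun n => (hLp n).toLp
  have hUu : ∀ n, U n =ᵐ[μ] u n := fun n => (hLp n).coeFn_toLp
  set K : ℕ → Set (Lp E 2 μ) := fun n => closure (convexHull ℝ (U '' Ici n))
  have hsub : ∀ (φ : α → E → ℝ) (m : ℝ) (n : ℕ), IsConcaveIntegrand μ R φ →
      (∀ k ≥ n, m ≤ ∫ t, φ t (u k t) ∂μ) →
      K n ⊆ {f : Lp E 2 μ | (∀ᵐ t ∂μ, f t ∈ R) ∧ m ≤ ∫ t, φ t (f t) ∂μ} := by
    intro φ m n hφ h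
    refine closure_minimal (convexHull_min ?_ (hφ.convex_superlevel hRconv m))
      (hφ.isClosed_superlevel hRcl m)
    rintro _ ⟨k, hk, rfl⟩
    refine ⟨?_, ?_⟩
    · filter_upwards [hUu k, huR k] with t h1 h2
      rwa [h1]
    · refine (h k hk).trans_eq (integral_congr_ae ?_)
      filter_upwards [hUu k] with t h1
      rw [h1]
  have hK0 : ∀ n, K n ⊆ {f : Lp E 2 μ | (∀ᵐ t ∂μ, f t ∈ R) ∧ (0 : ℝ) ≤ ∫ _, 0 ∂μ} :=
    fun n => hsub _ 0 n (IsConcaveIntegrand.zero hRconv) (by simp)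
  obtain ⟨v, hv⟩ := nonempty_iInter_of_antitone_closed_convex (K := K)
    (fun n m hnm => closure_mono (convexHull_mono (image_mono (Ici_subset_Ici.2 hnm))))
    (fun n => ⟨U n, subset_closure (subset_convexHull ℝ _ ⟨n, self_mem_Ici, rfl⟩)⟩)
    (fun n => isClosed_closure) (fun n => (convex_convexHull ℝ _).closure)
    (isBounded_iff_forall_norm_le.2 ⟨_, fun f hf => Lp.norm_le_of_ae_bound (abs_nonneg B)
      ((hK0 0 hf).1.mono fun t ht => hB' _ ht)⟩)
  rw [mem_iInter] at hv
  refine ⟨v, Lp.aestronglyMeasurable v, (hK0 0 (hv 0)).1, fun φ m hφ hm => ?_⟩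
  -- For each `ε` a whole tail lies in the superlevel set at `m - ε`, hence so does its closed
  -- convex hull, which contains `v`.
  refine le_of_forall_pos_sub_le fun ε hε => ?_
  obtain ⟨n, hn⟩ := eventually_atTop.1 (hm.eventually (le_mem_nhds (sub_lt_self m hε)))
  exact (hsub φ (m - ε) n hφ hn (hv n)).2

end IsConcaveIntegrand

end ConcaveIntegrand

/-! ### Compactness of Lipschitz paths and absolutely continuous primitives. -/

open Filter Topology in
/-- A uniformly bounded and uniformly Lipschitz sequence on a compact interval has a pointwise
convergent subsequence. -/
theorem exists_subseq_tendsto_of_lipschitzOnWith {f : ℕ → ℝ → ℝ} {a b B : ℝ} {K : NNReal}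
    (hf : ∀ n, LipschitzOnWith K (f n) (Icc a b)) (hB : ∀ n, ∀ t ∈ Icc a b, |f n t| ≤ B) :
    ∃ φ : ℕ → ℕ, StrictMono φ ∧ ∃ g : ℝ → ℝ, ∀ t ∈ Icc a b,
      Tendsto (fun n => f (φ n) t) atTop (𝓝 (g t)) := by
  set F : ℕ → BoundedContinuousFunction (Icc a b) ℝ := fun n =>
    BoundedContinuousFunction.mkOfCompact ⟨(Icc a b).domRestrict (f n), (hf n).continuousOn.domRestrict⟩
  have hcomp : IsCompact (closure (range F)) := by
    refine BoundedContinuousFunction.arzela_ascoli (Icc (-B) B) isCompact_Icc _ ?_ ?_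
    · rintro _ t ⟨n, rfl⟩
      exact abs_le.1 (hB n t t.2)
    · refine (LipschitzWith.uniformEquicontinuous _ K ?_).equicontinuous
      rintro ⟨_, n, rfl⟩
      exact (hf n).to_restrict
  obtain ⟨g, -, φ, hφ, hg⟩ := hcomp.tendsto_subseq fun n => subset_closure (mem_range_self n)
  refine ⟨φ, hφ, fun t => if h : t ∈ Icc a b then g ⟨t, h⟩ else 0, fun t ht => ?_⟩
  simp only [dif_pos ht]
  exact ((BoundedContinuousFunction.lipschitz_eval_const (⟨t, ht⟩ : Icc a b)).continuous.tendsto g).comp hg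

/-- An absolutely continuous function is the integral of its almost everywhere derivative. -/
theorem AbsolutelyContinuousOnInterval.eq_add_integral {f g : ℝ → ℝ} {T t : ℝ}
    (hf : AbsolutelyContinuousOnInterval f 0 T) (ht : t ∈ Icc 0 T)
    (hfg : ∀ᵐ s ∂(volume.restrict (Icc 0 T)), HasDerivAt f (g s) s) :
    f t = f 0 + ∫ s in (0 : ℝ)..t, g s := by
  have hsub : Icc 0 t ⊆ Icc 0 T := Icc_subset_Icc_right ht.2
  have h := (hf.mono (c := 0) (d := t)
    (by rwa [uIcc_of_le ht.1, uIcc_of_le (ht.1.trans ht.2)])).integral_deriv_eq_sub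
  rw [← intervalIntegral.integral_congr_ae (f := deriv f), h]
  · ring
  · filter_upwards [(ae_restrict_iff' measurableSet_Icc).1 hfg] with s hs hst
    rw [uIoc_of_le ht.1] at hst
    exact (hs (hsub (Ioc_subset_Icc_self hst))).deriv

/-- The primitive of an integrable function is differentiable almost everywhere. -/
theorem IntervalIntegrable.ae_restrict_hasDerivAt_integral {g : ℝ → ℝ} {T : ℝ} (hT : 0 ≤ T)
    (hg : IntervalIntegrable g volume 0 T) :
    ∀ᵐ t ∂(volume.restrict (Icc 0 T)), HasDerivAt (fun t => ∫ s in (0 : ℝ)..t, g s) (g t) t := by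
  refine (ae_restrict_iff' measurableSet_Icc).2 ?_
  filter_upwards [hg.ae_hasDerivAt_integral] with t h ht
  rw [uIcc_of_le hT] at h
  exact h ht 0 (left_mem_Icc.2 hT)

/-! ### Explicit solution of the state equations. -/

namespace RelocationModel

/-- Measurable controls within the bounds of the model. -/
structure IsControl (M : RelocationModel) (c z : ℝ → ℝ) : Prop where
  aemeasurable_consumption : AEMeasurable c (volume.restrict (Icc 0 M.T))
  aemeasurable_speed : AEMeasurable z (volume.restrict (Icc 0 M.T))
  consumption_mem : ∀ t ∈ Icc 0 M.T, c t ∈ Icc 0 M.C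
  speed_mem : ∀ t ∈ Icc 0 M.T, z t ∈ Icc (-M.Z) M.Z

/-- The location path generated by the control `z`. -/
noncomputable def location (M : RelocationModel) (z : ℝ → ℝ) (t : ℝ) : ℝ :=
  M.x₀ + ∫ s in (0 : ℝ)..t, z s

/-- The discounted cash flow of the controls `c` and `z`. -/
noncomputable def cashFlow (M : RelocationModel) (c z : ℝ → ℝ) (t : ℝ) : ℝ :=
  Real.exp (-M.r * t) * (M.w (M.location z t) - M.p * c t - M.ξ * z t ^ 2)

/-- The asset path generated by the controls `c` and `z`. -/
noncomputable def assets (M : RelocationModel) (c z : ℝ → ℝ) (t : ℝ) : ℝ :=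
  Real.exp (M.r * t) * (M.a₀ + ∫ s in (0 : ℝ)..t, M.cashFlow c z s)

variable {M : RelocationModel} {c z a x : ℝ → ℝ}

theorem IsTrajectory.location_eq_location (h : M.IsTrajectory c z a x) {t : ℝ}
    (ht : t ∈ Icc 0 M.T) : x t = M.location z t := by
  rw [h.absCont_location.eq_add_integral ht h.location_eq, h.location_init, location]

/-- The integrating factor `exp (-r t)` turns the asset equation into a pure integration. This gives
uniqueness of the states on the interval. -/
theorem IsTrajectory.assets_eq_assets (h : M.IsTrajectory c z a x) {t : ℝ}
    (ht : t ∈ Icc 0 M.T) : a t = M.assets c z t := by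
  have hexp : AbsolutelyContinuousOnInterval (fun s => Real.exp (-M.r * s)) 0 M.T :=
    ContDiffOn.absolutelyContinuousOnInterval (by fun_prop)
  have hder : ∀ᵐ s ∂(volume.restrict (Icc 0 M.T)),
      HasDerivAt (fun s => Real.exp (-M.r * s) * a s) (M.cashFlow c z s) s := by
    filter_upwards [h.assets_eq, ae_restrict_mem measurableSet_Icc] with s hs hsT
    have he : HasDerivAt (fun s => Real.exp (-M.r * s)) (Real.exp (-M.r * s) * (-M.r)) s := by
      simpa using ((hasDerivAt_id s).const_mul (-M.r)).exp
    refine (he.mul hs).congr_deriv ?_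
    rw [cashFlow, ← h.location_eq_location hsT]
    ring
  have := (hexp.fun_mul h.absCont_assets).eq_add_integral ht hder
  simp only [mul_zero, Real.exp_zero, one_mul, h.assets_init] at this
  rw [assets, ← this, ← mul_assoc, ← Real.exp_add]
  simp

namespace IsControl

theorem abs_speed_le (h : M.IsControl c z) {t : ℝ} (ht : t ∈ Icc 0 M.T) : |z t| ≤ M.Z :=
  abs_le.2 (h.speed_mem t ht)

theorem intervalIntegrable_speed (h : M.IsControl c z) (hT : 0 ≤ M.T) :
    IntervalIntegrable z volume 0 M.T := by
  rw [intervalIntegrable_iff_integrableOn_Icc_of_le hT]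
  refine Integrable.of_bound h.aemeasurable_speed.aestronglyMeasurable M.Z ?_
  filter_upwards [ae_restrict_mem measurableSet_Icc] with t ht using h.abs_speed_le ht

theorem lipschitzOnWith_location (h : M.IsControl c z) (hT : 0 ≤ M.T) :
    LipschitzOnWith M.Z.toNNReal (M.location z) (Icc 0 M.T) := by
  have hint := h.intervalIntegrable_speed hT
  have hsub : ∀ s ∈ Icc 0 M.T, IntervalIntegrable z volume 0 s := fun s hs =>
    hint.mono_set (by rw [uIcc_of_le hs.1, uIcc_of_le hT]; exact Icc_subset_Icc_right hs.2)
  refine LipschitzOnWith.of_dist_le_mul fun s hs t ht => ?_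
  rw [Real.dist_eq, Real.dist_eq, location, location, add_sub_add_left_eq_sub,
    intervalIntegral.integral_interval_sub_left (hsub s hs) (hsub t ht), ← Real.norm_eq_abs]
  refine (intervalIntegral.norm_integral_le_of_norm_le_const (C := M.Z) fun y hy => ?_).trans
    (mul_le_mul_of_nonneg_right (Real.le_coe_toNNReal _) (abs_nonneg _))
  have hy' := uIoc_subset_uIcc hy
  exact h.abs_speed_le (uIcc_subset_Icc ht hs hy')

theorem abs_location_le (h : M.IsControl c z) {t : ℝ} (ht : t ∈ Icc 0 M.T) :
    |M.location z t| ≤ |M.x₀| + M.Z.toNNReal * M.T := by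
  have hT := ht.1.trans ht.2
  have h1 := (h.lipschitzOnWith_location hT).dist_le_mul t ht 0 (left_mem_Icc.2 hT)
  have h0 : M.location z 0 = M.x₀ := by simp [location]
  rw [h0, Real.dist_eq, Real.dist_eq, sub_zero, abs_of_nonneg ht.1] at h1
  have h2 : (M.Z.toNNReal : ℝ) * t ≤ M.Z.toNNReal * M.T :=
    mul_le_mul_of_nonneg_left ht.2 NNReal.zero_le_coe
  have h3 := abs_add_le M.x₀ (M.location z t - M.x₀)
  rw [add_sub_cancel] at h3
  linarith

theorem abs_cashFlow_le (h : M.IsControl c z) (hM : M.StandingAssumptions) {B : ℝ}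
    (hB : ∀ y, |M.w y| ≤ B) {t : ℝ} (ht : t ∈ Icc 0 M.T) :
    |M.cashFlow c z t| ≤ B + M.p * M.C + M.ξ * M.Z ^ 2 := by
  have hexp : Real.exp (-M.r * t) ≤ 1 := by
    rw [Real.exp_le_one_iff]
    nlinarith [hM.r_pos, ht.1]
  have hc := h.consumption_mem t ht
  have hz : z t ^ 2 ≤ M.Z ^ 2 := sq_le_sq' (h.speed_mem t ht).1 (h.speed_mem t ht).2
  have h1 : M.p * c t ≤ M.p * M.C := mul_le_mul_of_nonneg_left hc.2 hM.p_pos.le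
  have h2 : 0 ≤ M.p * c t := mul_nonneg hM.p_pos.le hc.1
  have h3 : M.ξ * z t ^ 2 ≤ M.ξ * M.Z ^ 2 := mul_le_mul_of_nonneg_left hz hM.ξ_nonneg
  have h4 : 0 ≤ M.ξ * z t ^ 2 := mul_nonneg hM.ξ_nonneg (sq_nonneg _)
  have h5 := abs_le.1 (hB (M.location z t))
  rw [cashFlow, abs_mul, abs_of_pos (Real.exp_pos _)]
  refine (mul_le_of_le_one_left (abs_nonneg _) hexp).trans (abs_le.2 ⟨?_, ?_⟩) <;> linarith

theorem aestronglyMeasurable_wage (h : M.IsControl c z) (hM : M.StandingAssumptions) :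
    AEStronglyMeasurable (fun t => M.w (M.location z t)) (volume.restrict (Icc 0 M.T)) :=
  (hM.w_contDiff.continuous.comp_continuousOn
    (h.lipschitzOnWith_location hM.T_pos.le).continuousOn).aestronglyMeasurable measurableSet_Icc

theorem intervalIntegrable_cashFlow (h : M.IsControl c z) (hM : M.StandingAssumptions) :
    IntervalIntegrable (M.cashFlow c z) volume 0 M.T := by
  obtain ⟨B, hB⟩ := hM.w_bounded
  rw [intervalIntegrable_iff_integrableOn_Icc_of_le hM.T_pos.le]
  refine Integrable.of_bound ?_ (B + M.p * M.C + M.ξ * M.Z ^ 2) ?_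
  · have hw := (h.aestronglyMeasurable_wage hM).aemeasurable
    have hc := h.aemeasurable_consumption
    have hz := h.aemeasurable_speed
    refine AEMeasurable.aestronglyMeasurable ?_
    exact (by fun_prop : Measurable fun t : ℝ => Real.exp (-M.r * t)).aemeasurable.mul
      ((hw.sub (hc.const_mul _)).sub ((hz.pow_const 2).const_mul _))
  · filter_upwards [ae_restrict_mem measurableSet_Icc] with t ht using h.abs_cashFlow_le hM hB ht

theorem isTrajectory (h : M.IsControl c z) (hM : M.StandingAssumptions) :
    M.IsTrajectory c z (M.assets c z) (M.location z) where
  absCont_assets := by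
    have hexp : AbsolutelyContinuousOnInterval (fun s => Real.exp (M.r * s)) 0 M.T :=
      ContDiffOn.absolutelyContinuousOnInterval (by fun_prop)
    have hconst : AbsolutelyContinuousOnInterval (fun _ => M.a₀) 0 M.T :=
      ContDiffOn.absolutelyContinuousOnInterval (by fun_prop)
    exact hexp.fun_mul (hconst.fun_add ((h.intervalIntegrable_cashFlow
      hM).absolutelyContinuousOnInterval_intervalIntegral left_mem_uIcc))
  absCont_location := (show LipschitzOnWith M.Z.toNNReal (M.location z) (uIcc 0 M.T) by
    rw [uIcc_of_le hM.T_pos.le]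
    exact h.lipschitzOnWith_location hM.T_pos.le).absolutelyContinuousOnInterval
  assets_init := by simp [assets]
  location_init := by simp [location]
  assets_eq := by
    filter_upwards [(h.intervalIntegrable_cashFlow
      hM).ae_restrict_hasDerivAt_integral hM.T_pos.le] with t ht
    have he : HasDerivAt (fun s => Real.exp (M.r * s)) (Real.exp (M.r * t) * M.r) t := by
      simpa using ((hasDerivAt_id t).const_mul M.r).exp
    refine (he.mul (ht.const_add M.a₀)).congr_deriv ?_
    have hee : Real.exp (M.r * t) * Real.exp (-M.r * t) = 1 := by
      rw [← Real.exp_add]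
      simp
    rw [assets, cashFlow]
    linear_combination ((M.w (M.location z t) - M.p * c t - M.ξ * z t ^ 2)) * hee
  location_eq := by
    filter_upwards [(h.intervalIntegrable_speed
      hM.T_pos.le).ae_restrict_hasDerivAt_integral hM.T_pos.le] with t ht
    exact ht.const_add M.x₀

end IsControl

theorem mem_admissible_iff (hM : M.StandingAssumptions) :
    (c, z) ∈ M.admissible ↔ M.IsControl c z ∧ 0 ≤ M.assets c z M.T := by
  have hT : M.T ∈ Icc 0 M.T := right_mem_Icc.2 hM.T_pos.le
  constructor
  · rintro ⟨hc, hz, hcC, hzZ, a, x, hax, ha⟩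
    exact ⟨⟨hc, hz, hcC, fun t ht => abs_le.1 (hzZ t ht)⟩, hax.assets_eq_assets hT ▸ ha⟩
  · rintro ⟨h, ha⟩
    exact ⟨h.1, h.2, h.3, fun t ht => h.abs_speed_le ht, _, _, h.isTrajectory hM, ha⟩

theorem wage_nonneg (hM : M.StandingAssumptions) {y : ℝ} (hy : y ∈ Icc (0 : ℝ) 1) :
    0 ≤ M.w y := by
  rw [← closure_Ioo zero_ne_one] at hy
  exact closure_minimal (t := {y | 0 ≤ M.w y}) (fun y hy => (hM.w_pos y hy).le)
    (isClosed_le continuous_const hM.w_contDiff.continuous) hy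

/-- Staying at `x₀` without consuming earns a wage that is nonnegative on the closed unit interval,
so assets never become negative. -/
theorem zero_mem_admissible (hM : M.StandingAssumptions) :
    ((fun _ => 0, fun _ => 0) : (ℝ → ℝ) × (ℝ → ℝ)) ∈ M.admissible := by
  refine (mem_admissible_iff hM).2 ⟨⟨aemeasurable_const, aemeasurable_const,
    fun t _ => ⟨le_rfl, hM.C_nonneg⟩, fun t _ => ⟨neg_nonpos.2 hM.Z_nonneg, hM.Z_nonneg⟩⟩, ?_⟩
  refine mul_nonneg (Real.exp_pos _).le (add_nonneg hM.a₀_nonneg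
    (intervalIntegral.integral_nonneg hM.T_pos.le fun t _ => ?_))
  have := wage_nonneg hM hM.x₀_mem
  simp only [cashFlow, location, intervalIntegral.integral_zero]
  have := (Real.exp_pos (-M.r * t)).le
  simp only [add_zero, mul_zero, ne_eq, OfNat.ofNat_ne_zero, not_false_eq_true, zero_pow, sub_zero]
  positivity

end RelocationModel

/-! ### The integrands of the model. -/

namespace RelocationModel

variable {M : RelocationModel} {c z : ℝ → ℝ}

/-- The set of values that the pair of controls may take, as a rectangle in the complex plane. -/
def controlSet (M : RelocationModel) : Set ℂ := Icc 0 M.C ×ℂ Icc (-M.Z) M.Z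

/-- The pair of controls `c`, `z` as the complex-valued function `c + i z`. -/
def controlPath (c z : ℝ → ℝ) (t : ℝ) : ℂ := ⟨c t, z t⟩

theorem convex_controlSet : Convex ℝ M.controlSet :=
  ((convex_Icc (0 : ℝ) M.C).linear_preimage Complex.reLm).inter
    ((convex_Icc (-M.Z) M.Z).linear_preimage Complex.imLm)

theorem isClosed_controlSet : IsClosed M.controlSet := isClosed_Icc.reProdIm isClosed_Icc

theorem isBounded_controlSet : Bornology.IsBounded M.controlSet :=
  (Metric.isBounded_Icc _ _).reProdIm (Metric.isBounded_Icc _ _)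

theorem sq_im_le {v : ℂ} (hv : v ∈ M.controlSet) : v.im ^ 2 ≤ M.Z ^ 2 :=
  sq_le_sq' hv.2.1 hv.2.2

namespace IsControl

theorem controlPath_mem (h : M.IsControl c z) :
    ∀ᵐ t ∂(volume.restrict (Icc 0 M.T)), controlPath c z t ∈ M.controlSet := by
  filter_upwards [ae_restrict_mem measurableSet_Icc] with t ht
  exact ⟨h.consumption_mem t ht, h.speed_mem t ht⟩

theorem aestronglyMeasurable_controlPath (h : M.IsControl c z) :
    AEStronglyMeasurable (controlPath c z) (volume.restrict (Icc 0 M.T)) :=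
  (Complex.measurableEquivRealProd.symm.measurable.comp_aemeasurable
    (h.aemeasurable_consumption.prodMk h.aemeasurable_speed)).aestronglyMeasurable

end IsControl

/-- An almost everywhere admissible complex-valued function has an everywhere admissible version. -/
theorem exists_isControl_ae_eq (hM : M.StandingAssumptions) {v : ℝ → ℂ}
    (hv : AEStronglyMeasurable v (volume.restrict (Icc 0 M.T)))
    (hvR : ∀ᵐ t ∂(volume.restrict (Icc 0 M.T)), v t ∈ M.controlSet) :
    ∃ c z : ℝ → ℝ, M.IsControl c z ∧
      controlPath c z =ᵐ[volume.restrict (Icc 0 M.T)] v := by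
  have hZ : -M.Z ≤ M.Z := neg_le_self hM.Z_nonneg
  -- Clamping enforces the bounds at every time and changes `v` only on a null set.
  refine ⟨fun t => projIcc 0 M.C hM.C_nonneg (v t).re, fun t => projIcc (-M.Z) M.Z hZ (v t).im,
    ⟨?_, ?_, fun t _ => Subtype.coe_prop _, fun t _ => Subtype.coe_prop _⟩, ?_⟩
  · exact (continuous_subtype_val.comp (continuous_projIcc.comp
      Complex.continuous_re)).measurable.comp_aemeasurable hv.aemeasurable
  · exact (continuous_subtype_val.comp (continuous_projIcc.comp
      Complex.continuous_im)).measurable.comp_aemeasurable hv.aemeasurable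
  · filter_upwards [hvR] with t ht
    exact Complex.ext (congrArg Subtype.val (projIcc_of_mem hM.C_nonneg ht.1))
      (congrArg Subtype.val (projIcc_of_mem hZ ht.2))

/-- The discounted instantaneous utility as a function of time and control value. -/
noncomputable def utilityIntegrand (M : RelocationModel) (t : ℝ) (v : ℂ) : ℝ :=
  Real.exp (-M.ρ * t) * (v.re ^ (1 - M.θ) / (1 - M.θ) - M.η * v.im ^ 2)

/-- The discounted instantaneous cost of the controls, with negative sign. -/
noncomputable def costIntegrand (M : RelocationModel) (t : ℝ) (v : ℂ) : ℝ :=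
  Real.exp (-M.r * t) * (-M.p * v.re - M.ξ * v.im ^ 2)

/-- The integrand `k v.im` cut off after time `s`. -/
noncomputable def speedIntegrand (k s t : ℝ) (v : ℂ) : ℝ := (Iic s).indicator (fun _ => k) t * v.im

theorem convexOn_sq_im : ConvexOn ℝ M.controlSet fun v => v.im ^ 2 :=
  (((even_two.convexOn_pow (𝕜 := ℝ)).comp_linearMap Complex.imLm).subset (subset_univ _)
    convex_controlSet)

/-- The exponent `1 - θ` lies in `(0, 1)`, so the power is concave and continuous up to zero
consumption; `η ≥ 0` makes the quadratic term concave. -/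
theorem isConcaveIntegrand_utility (hM : M.StandingAssumptions) :
    IsConcaveIntegrand (volume.restrict (Icc 0 M.T)) M.controlSet M.utilityIntegrand where
  concaveOn t := by
    have hθ := hM.θ_mem
    have h1 : ConcaveOn ℝ M.controlSet fun v => v.re ^ (1 - M.θ) :=
      ((Real.concaveOn_rpow (sub_nonneg.2 hθ.2.le) (sub_le_self 1 hθ.1.le)).comp_linearMap
        Complex.reLm).subset (fun v hv => hv.1.1) convex_controlSet
    have h2 := ((h1.smul (inv_nonneg.2 (sub_nonneg.2 hθ.2.le))).sub
      (convexOn_sq_im.smul hM.η_nonneg)).smul (Real.exp_pos (-M.ρ * t)).le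
    refine h2.congr fun v _ => ?_
    simp only [utilityIntegrand, smul_eq_mul, Pi.sub_apply, div_eq_inv_mul]
  continuousOn t := by
    have h : Continuous fun v : ℂ => v.re ^ (1 - M.θ) :=
      Complex.continuous_re.rpow_const fun _ => Or.inr (sub_nonneg.2 hM.θ_mem.2.le)
    exact (continuous_const.mul ((h.div_const _).sub
      (continuous_const.mul (Complex.continuous_im.pow 2)))).continuousOn
  measurable := by
    unfold utilityIntegrand Function.uncurry
    fun_prop
  bounded := by
    have hθ : 0 ≤ 1 - M.θ := sub_nonneg.2 hM.θ_mem.2.le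
    refine ⟨M.C ^ (1 - M.θ) / (1 - M.θ) + M.η * M.Z ^ 2, ?_⟩
    filter_upwards [ae_restrict_mem measurableSet_Icc] with t ht v hv
    have hexp : Real.exp (-M.ρ * t) ≤ 1 := by
      rw [Real.exp_le_one_iff]
      nlinarith [hM.ρ_pos, ht.1]
    have h1 : v.re ^ (1 - M.θ) / (1 - M.θ) ≤ M.C ^ (1 - M.θ) / (1 - M.θ) :=
      div_le_div_of_nonneg_right (Real.rpow_le_rpow hv.1.1 hv.1.2 hθ) hθ
    have h2 : 0 ≤ v.re ^ (1 - M.θ) / (1 - M.θ) := div_nonneg (Real.rpow_nonneg hv.1.1 _) hθ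
    have h3 : M.η * v.im ^ 2 ≤ M.η * M.Z ^ 2 :=
      mul_le_mul_of_nonneg_left (sq_im_le hv) hM.η_nonneg
    have h4 : 0 ≤ M.η * v.im ^ 2 := mul_nonneg hM.η_nonneg (sq_nonneg _)
    rw [utilityIntegrand, abs_mul, abs_of_pos (Real.exp_pos _)]
    refine (mul_le_of_le_one_left (abs_nonneg _) hexp).trans (abs_le.2 ⟨?_, ?_⟩) <;> linarith

theorem isConcaveIntegrand_cost (hM : M.StandingAssumptions) :
    IsConcaveIntegrand (volume.restrict (Icc 0 M.T)) M.controlSet M.costIntegrand where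
  concaveOn t := by
    have h1 : ConcaveOn ℝ M.controlSet fun v => -M.p * v.re :=
      ((-M.p) • Complex.reLm).concaveOn convex_controlSet
    exact (h1.sub (convexOn_sq_im.smul hM.ξ_nonneg)).smul (Real.exp_pos (-M.r * t)).le
  continuousOn t := by
    unfold costIntegrand
    fun_prop
  measurable := by
    unfold costIntegrand Function.uncurry
    fun_prop
  bounded := by
    refine ⟨M.p * M.C + M.ξ * M.Z ^ 2, ?_⟩
    filter_upwards [ae_restrict_mem measurableSet_Icc] with t ht v hv
    have hexp : Real.exp (-M.r * t) ≤ 1 := by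
      rw [Real.exp_le_one_iff]
      nlinarith [hM.r_pos, ht.1]
    have h1 : M.p * v.re ≤ M.p * M.C := mul_le_mul_of_nonneg_left hv.1.2 hM.p_pos.le
    have h2 : 0 ≤ M.p * v.re := mul_nonneg hM.p_pos.le hv.1.1
    have h3 : M.ξ * v.im ^ 2 ≤ M.ξ * M.Z ^ 2 :=
      mul_le_mul_of_nonneg_left (sq_im_le hv) hM.ξ_nonneg
    have h4 : 0 ≤ M.ξ * v.im ^ 2 := mul_nonneg hM.ξ_nonneg (sq_nonneg _)
    rw [costIntegrand, abs_mul, abs_of_pos (Real.exp_pos _)]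
    refine (mul_le_of_le_one_left (abs_nonneg _) hexp).trans (abs_le.2 ⟨?_, ?_⟩) <;> linarith

/-- Linearity in `v` gives concavity for either sign of `k`. -/
theorem isConcaveIntegrand_speed (k s : ℝ) :
    IsConcaveIntegrand (volume.restrict (Icc 0 M.T)) M.controlSet (speedIntegrand k s) where
  concaveOn t := (((Iic s).indicator (fun _ => k) t) • Complex.imLm).concaveOn convex_controlSet
  continuousOn t := by
    unfold speedIntegrand
    fun_prop
  measurable := by
    unfold speedIntegrand Function.uncurry
    have h : Measurable ((Iic s).indicator fun _ => k) := measurable_const.indicator measurableSet_Iic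
    fun_prop
  bounded := by
    refine ⟨|k| * M.Z, Filter.Eventually.of_forall fun t v hv => ?_⟩
    rw [speedIntegrand, abs_mul]
    refine mul_le_mul ?_ (abs_le.2 hv.2) (abs_nonneg _) (abs_nonneg _)
    by_cases h : t ∈ Iic s <;> simp [h]

/-! ### Terminal assets, utility of assets, and passage to the limit. -/

/-- The discounted total wage along a location path. -/
noncomputable def totalWage (M : RelocationModel) (y : ℝ → ℝ) : ℝ :=
  ∫ t in Icc 0 M.T, Real.exp (-M.r * t) * M.w (y t)

/-- The utility of assets `b` at the horizon. -/
noncomputable def bequest (M : RelocationModel) (b : ℝ) : ℝ :=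
  Real.exp (-M.ρ * M.T) * (b ^ (1 - M.θ) / (1 - M.θ))

theorem continuous_bequest (hM : M.StandingAssumptions) : Continuous M.bequest :=
  continuous_const.mul ((Real.continuous_rpow_const (sub_nonneg.2 hM.θ_mem.2.le)).div_const _)

theorem bequest_le_bequest (hM : M.StandingAssumptions) {b b' : ℝ} (hb : 0 ≤ b) (h : b ≤ b') :
    M.bequest b ≤ M.bequest b' := by
  have hθ : 0 ≤ 1 - M.θ := sub_nonneg.2 hM.θ_mem.2.le
  exact mul_le_mul_of_nonneg_left
    (div_le_div_of_nonneg_right (Real.rpow_le_rpow hb h hθ) hθ) (Real.exp_pos _).le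

theorem objective_eq (hT : 0 ≤ M.T) (a : ℝ → ℝ) :
    M.objective c z a = (∫ t in Icc 0 M.T, M.utilityIntegrand t (controlPath c z t)) +
      M.bequest (a M.T) := by
  rw [objective, intervalIntegral.integral_of_le hT, ← integral_Icc_eq_integral_Ioc]
  rfl

theorem integral_speedIntegrand (k : ℝ) {s : ℝ} (hs : s ∈ Icc 0 M.T) :
    ∫ t in Icc 0 M.T, speedIntegrand k s t (controlPath c z t) =
      k * ∫ t in (0 : ℝ)..s, z t := by
  have h : ∀ t, speedIntegrand k s t (controlPath c z t) =
      (Iic s).indicator (fun t => k * z t) t := fun t => by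
    by_cases ht : t ∈ Iic s <;> simp [speedIntegrand, controlPath, ht]
  simp only [h]
  rw [integral_indicator measurableSet_Iic, Measure.restrict_restrict measurableSet_Iic,
    intervalIntegral.integral_of_le hs.1, ← integral_Icc_eq_integral_Ioc, ← integral_const_mul]
  congr 2
  ext t
  simp only [mem_inter_iff, mem_Iic, mem_Icc]
  have := hs.2
  grind

/-- This separates the wage, handled by convergence of locations, from the control costs, handled by
concavity. -/
theorem IsControl.assets_horizon_eq (h : M.IsControl c z) (hM : M.StandingAssumptions) :
    M.assets c z M.T = Real.exp (M.r * M.T) * (M.a₀ + (M.totalWage (M.location z) +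
      ∫ t in Icc 0 M.T, M.costIntegrand t (controlPath c z t))) := by
  have hcost := (isConcaveIntegrand_cost hM).integrable h.aestronglyMeasurable_controlPath
    h.controlPath_mem
  have hflow := (intervalIntegrable_iff_integrableOn_Icc_of_le hM.T_pos.le).1
    (h.intervalIntegrable_cashFlow hM)
  have hsum : ∀ t, Real.exp (-M.r * t) * M.w (M.location z t) =
      M.cashFlow c z t - M.costIntegrand t (controlPath c z t) := fun t => by
    rw [cashFlow, costIntegrand, controlPath]
    ring
  rw [assets, totalWage]
  simp only [hsum]
  rw [integral_sub hflow hcost, sub_add_cancel, intervalIntegral.integral_of_le hM.T_pos.le,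
    ← integral_Icc_eq_integral_Ioc]

open Filter Topology in
theorem tendsto_totalWage (hM : M.StandingAssumptions) {z : ℕ → ℝ → ℝ} {c : ℕ → ℝ → ℝ} {y : ℝ → ℝ}
    (h : ∀ n, M.IsControl (c n) (z n))
    (hy : ∀ t ∈ Icc 0 M.T, Tendsto (fun n => M.location (z n) t) atTop (𝓝 (y t))) :
    Tendsto (fun n => M.totalWage (M.location (z n))) atTop (𝓝 (M.totalWage y)) := by
  obtain ⟨B, hB⟩ := hM.w_bounded
  refine tendsto_integral_of_dominated_convergence (fun _ => B) (fun n => ?_)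
    (integrable_const B) (fun n => ?_) ?_
  · exact (by fun_prop : Continuous fun t : ℝ => Real.exp (-M.r * t)).aestronglyMeasurable.mul
      ((h n).aestronglyMeasurable_wage hM)
  · filter_upwards [ae_restrict_mem measurableSet_Icc] with t ht
    have hexp : Real.exp (-M.r * t) ≤ 1 := by
      rw [Real.exp_le_one_iff]
      nlinarith [hM.r_pos, ht.1]
    rw [norm_mul, Real.norm_of_nonneg (Real.exp_pos _).le]
    exact (mul_le_of_le_one_left (norm_nonneg _) hexp).trans (hB _)
  · filter_upwards [ae_restrict_mem measurableSet_Icc] with t ht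
    exact ((hM.w_contDiff.continuous.tendsto _).comp (hy t ht)).const_mul _

/-- The utility from the running controls and the terminal assets are bounded. -/
theorem exists_bound_utility_assets (hM : M.StandingAssumptions) :
    ∃ B : ℝ, ∀ c z, M.IsControl c z →
      |∫ t in Icc 0 M.T, M.utilityIntegrand t (controlPath c z t)| ≤ B ∧
      |M.assets c z M.T| ≤ B := by
  obtain ⟨B₁, hB₁⟩ := (isConcaveIntegrand_utility hM).bounded
  obtain ⟨B, hB⟩ := hM.w_bounded
  set B₂ := B + M.p * M.C + M.ξ * M.Z ^ 2
  refine ⟨max (B₁ * volume.real (Icc 0 M.T))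
    (Real.exp (M.r * M.T) * (|M.a₀| + B₂ * |M.T - 0|)), fun c z h => ⟨?_, ?_⟩⟩
  · refine le_max_of_le_left ?_
    have := norm_integral_le_of_norm_le_const (μ := volume.restrict (Icc 0 M.T))
      (f := fun t => M.utilityIntegrand t (controlPath c z t)) (C := B₁) (by
        filter_upwards [hB₁, h.controlPath_mem] with t h1 h2 using h1 _ h2)
    rwa [measureReal_restrict_apply_univ] at this
  · refine le_max_of_le_right ?_
    rw [assets, abs_mul, abs_of_pos (Real.exp_pos _)]
    refine mul_le_mul_of_nonneg_left ((abs_add_le _ _).trans (add_le_add_right ?_ _))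
      (Real.exp_pos _).le
    rw [← Real.norm_eq_abs]
    refine intervalIntegral.norm_integral_le_of_norm_le_const fun t ht => ?_
    rw [uIoc_of_le hM.T_pos.le] at ht
    exact h.abs_cashFlow_le hM hB (Ioc_subset_Icc_self ht)

open Filter Topology in
/-- Along a sequence of controls for which the running utility and the terminal assets converge,
some controls do at least as well as the limits in both respects. -/
theorem exists_isControl_ge_limit (hM : M.StandingAssumptions) {c z : ℕ → ℝ → ℝ}
    (h : ∀ n, M.IsControl (c n) (z n)) {I A : ℝ}
    (hI : Tendsto (fun n => ∫ t in Icc 0 M.T, M.utilityIntegrand t (controlPath (c n) (z n) t))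
      atTop (𝓝 I))
    (hA : Tendsto (fun n => M.assets (c n) (z n) M.T) atTop (𝓝 A)) :
    ∃ c' z', M.IsControl c' z' ∧
      I ≤ ∫ t in Icc 0 M.T, M.utilityIntegrand t (controlPath c' z' t) ∧
      A ≤ M.assets c' z' M.T := by
  obtain ⟨k, hk, y, hy⟩ := exists_subseq_tendsto_of_lipschitzOnWith
    (fun n => (h n).lipschitzOnWith_location hM.T_pos.le) (fun n t ht => (h n).abs_location_le ht)
  obtain ⟨v, hv, hvR, hvφ⟩ := IsConcaveIntegrand.exists_upper_limit
    (isClosed_controlSet (M := M)) convex_controlSet isBounded_controlSet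
    (fun n => (h (k n)).aestronglyMeasurable_controlPath) (fun n => (h (k n)).controlPath_mem)
  obtain ⟨c', z', h', hv'⟩ := exists_isControl_ae_eq hM hv hvR
  have hlim : ∀ (φ : ℝ → ℂ → ℝ) (m : ℝ),
      IsConcaveIntegrand (volume.restrict (Icc 0 M.T)) M.controlSet φ →
      Tendsto (fun n => ∫ t in Icc 0 M.T, φ t (controlPath (c (k n)) (z (k n)) t)) atTop (𝓝 m) →
      m ≤ ∫ t in Icc 0 M.T, φ t (controlPath c' z' t) := fun φ m hφ hm => by
    refine (hvφ φ m hφ hm).trans_eq (integral_congr_ae ?_)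
    filter_upwards [hv'] with t ht
    rw [ht]
  have hloc : ∀ t ∈ Icc 0 M.T, y t = M.location z' t := by
    intro t ht
    -- The one-sided limit inequality for `l = 1` and `l = -1` forces equality.
    have hspeed : ∀ l : ℝ, l * (y t - M.x₀) ≤ l * ∫ s in (0 : ℝ)..t, z' s := fun l => by
      have := hlim _ (l * (y t - M.x₀)) (isConcaveIntegrand_speed l t) (by
        simp only [integral_speedIntegrand l ht]
        refine (((hy t ht).sub_const M.x₀).const_mul l).congr fun n => ?_
        rw [location, add_sub_cancel_left])
      rwa [integral_speedIntegrand l ht] at this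
    have h1 := hspeed 1
    have h2 := hspeed (-1)
    rw [location]
    linarith
  refine ⟨c', z', h', hlim _ I (isConcaveIntegrand_utility hM) (hI.comp hk.tendsto_atTop), ?_⟩
  have hy' : ∀ t ∈ Icc 0 M.T, Tendsto (fun n => M.location (z (k n)) t) atTop
      (𝓝 (M.location z' t)) := fun t ht => hloc t ht ▸ hy t ht
  have hwage := tendsto_totalWage hM (fun n => h (k n)) hy'
  -- The cost integrals converge because both terminal assets and total wage do; their limit is `exp
  -- (-r T) A - a₀` minus the limiting wage.
  have hcost := hlim _ _ (isConcaveIntegrand_cost hM)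
    (((((hA.comp hk.tendsto_atTop).const_mul (Real.exp (M.r * M.T))⁻¹).sub_const M.a₀).sub
      hwage).congr fun n => by
        simp only [Function.comp_apply]
        rw [(h (k n)).assets_horizon_eq hM, inv_mul_cancel_left₀ (Real.exp_ne_zero _)]
        ring)
  rw [h'.assets_horizon_eq hM, ← inv_mul_le_iff₀ (Real.exp_pos _)]
  linarith

end RelocationModel

/-! ### Existence of an optimal control. -/

open RelocationModel Filter Topology in
theorem mainTheorem1 (M : RelocationModel) (hM : M.StandingAssumptions) :
    ∃ c z : ℝ → ℝ, M.IsOptimal c z := by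
  have hT := hM.T_pos.le
  have hTT : M.T ∈ Icc 0 M.T := right_mem_Icc.2 hT
  set I : (ℝ → ℝ) × (ℝ → ℝ) → ℝ := fun u =>
    ∫ t in Icc 0 M.T, M.utilityIntegrand t (controlPath u.1 u.2 t)
  set A : (ℝ → ℝ) × (ℝ → ℝ) → ℝ := fun u => M.assets u.1 u.2 M.T
  set V : (ℝ → ℝ) × (ℝ → ℝ) → ℝ := fun u => I u + M.bequest (A u)
  obtain ⟨B, hB⟩ := exists_bound_utility_assets hM
  have hadm : ∀ u ∈ M.admissible, M.IsControl u.1 u.2 ∧ 0 ≤ A u := fun u hu =>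
    (mem_admissible_iff hM).1 hu
  have hbdd : BddAbove (V '' M.admissible) := by
    refine ⟨B + M.bequest B, ?_⟩
    rintro _ ⟨u, hu, rfl⟩
    have hu' := hadm u hu
    have hBu := hB _ _ hu'.1
    exact add_le_add ((le_abs_self _).trans hBu.1)
      (bequest_le_bequest hM hu'.2 ((le_abs_self _).trans hBu.2))
  obtain ⟨s, -, hs, hsV⟩ :=
    exists_seq_tendsto_sSup (Set.Nonempty.image V ⟨_, zero_mem_admissible hM⟩) hbdd
  choose u hu huV using hsV
  -- Convergence of the payoff alone is not enough: running utility and terminal assets must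
  -- converge separately.
  obtain ⟨⟨I₀, A₀⟩, -, k, hk, hlim⟩ := (isCompact_Icc (a := -B) (b := B)).prod
    (isCompact_Icc (a := -B) (b := B)) |>.tendsto_subseq (x := fun n => (I (u n), A (u n)))
    fun n => ⟨abs_le.1 (hB _ _ (hadm _ (hu n)).1).1, abs_le.1 (hB _ _ (hadm _ (hu n)).1).2⟩
  have hI : Tendsto (fun n => I (u (k n))) atTop (𝓝 I₀) := (continuous_fst.tendsto _).comp hlim
  have hA : Tendsto (fun n => A (u (k n))) atTop (𝓝 A₀) := (continuous_snd.tendsto _).comp hlim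
  -- This yields both the terminal constraint for the limit control and the monotonicity of
  -- `bequest` from `A₀` upwards.
  have hA₀ : 0 ≤ A₀ := ge_of_tendsto' hA fun n => (hadm _ (hu _)).2
  have hsup : sSup (V '' M.admissible) = I₀ + M.bequest A₀ :=
    tendsto_nhds_unique (hs.comp hk.tendsto_atTop)
      ((hI.add (((continuous_bequest hM).tendsto _).comp hA)).congr fun n => huV (k n))
  obtain ⟨c, z, h, hIc, hAc⟩ := exists_isControl_ge_limit hM
    (fun n => (hadm _ (hu (k n))).1) hI hA
  refine ⟨c, z, (mem_admissible_iff hM).2 ⟨h, hA₀.trans hAc⟩,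
    fun a x hax c' z' hadm' a' x' hax' => ?_⟩
  rw [objective_eq hT, objective_eq hT, hax.assets_eq_assets hTT, hax'.assets_eq_assets hTT]
  calc V (c', z') ≤ sSup (V '' M.admissible) := le_csSup hbdd ⟨_, hadm', rfl⟩
    _ = I₀ + M.bequest A₀ := hsup
    _ ≤ _ := add_le_add hIc (bequest_le_bequest hM hA₀ hAc)
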